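/- Let $Q\in\mathbb{R}^{d\times d}$ be symmetric positive definite with smallest eigenvalue $\mu$ and largest eigenvalue $L$, let $p\in\mathbb{R}^d$, $r\in\mathbb{R}$, let $f(x)=\frac12 x^TQx+p^Tx+r$, and let $x_*$ be its minimizer. The generalized momentum method with stepsize $\alpha>0$, momentum parameters $\beta,\nu\ge 0$ and additive gradient errors $w_k\in\mathbb{R}^d$ is $$x_{k+1}=x_k-\alpha(\nabla f(y_k)+w_k)+\beta(x_k-x_{k-1}),\qquad y_k=x_k+\nu(x_k-x_{k-1}),$$ with state $\xi_k=(x_k,x_{k-1})$; put $\xi_*=(x_*,x_*)$. Its $\ell_2$ gain $L_{2,*}\in[0,\infty]$ is the infimum of all $\gamma\ge 0$ for which there is a function $H:\mathbb{R}^{2d}\to[0,\infty)$ with $H(\xi_*)=0$ such that, for every initialization $\xi_0\in\mathbb{R}^{2d}$ and every sequence $w$ with $\sum_{k\ge0}\|w_k\|^2<\infty$, $$\sum_{k\ge 0}\bigl(f(x_k)-f(x_*)\bigr)\le\gamma^2\sum_{k\ge 0}\|w_k\|^2+H(\xi_0).$$ Let $Q=U\Lambda U^T$ be an eigenvalue decomposition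 with $U$ orthogonal and $\Lambda$ diagonal, and let $$A_Q=\begin{bmatrix}(1+\beta)I-\alpha(1+\nu)Q & -\beta I+\alpha\nu Q\\ I&0\end{bmatrix},\quad B=\begin{bmatrix}-\alpha I\\0\end{bmatrix},\quad T=\begin{bmatrix}\tfrac1{\sqrt2}\Lambda^{1/2}U^T & 0\end{bmatrix},$$ $G(z)=T(zI-A_Q)^{-1}B$ and $H_\infty=\max_{z\in\mathbb{C},|z|=1}\|G(z)\|$ (spectral norm). Write $b_\lambda=\alpha\lambda(1+\nu)-(1+\beta)$ and $c_\lambda=\beta-\alpha\lambda\nu$. Consider gradient descent (GD), i.e. $\beta=\nu=0$. Then $c_\lambda=0$ and $b_\lambda=\alpha\lambda-1$. For $\alpha>0$, the spectral radius satisfies $\rho(A_Q)<1$ if and only if $\alpha<2/L$, and for $0<\alpha<2/L$ the maximum defining $H_\infty$ is attained and $$L_{2,*}=H_\infty=\begin{cases}\dfrac{1}{\sqrt{2\mu}} & \text{if } 0<\alpha\le\dfrac{2}{L+\sqrt{L\mu}},\\[2ex] \dfrac{\alpha\sqrt L}{\sqrt2\,(2-\alpha L)} & \text{if } \dfrac{2}{L+\sqrt{L\mu}}<\alpha<\dfrac2L.\end{cases}$$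 In particular, $L_{2,*}=H_\infty\to\infty$ as $\alpha\uparrow 2/L$. -/

import Mathlib

open Filter Topology
open scoped ENNReal NNReal Matrix

noncomputable section

/-- The quadratic objective `f(x) = (1/2) xᵀ Q x + pᵀ x + r` on `ℝᵈ`. -/
def quadObjective {d : ℕ} (Q : Matrix (Fin d) (Fin d) ℝ) (p : EuclideanSpace ℝ (Fin d)) (r : ℝ)
    (x : EuclideanSpace ℝ (Fin d)) : ℝ :=
  1 / 2 * (x.ofLp ⬝ᵥ (Q *ᵥ x.ofLp)) + p.ofLp ⬝ᵥ x.ofLp + r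

/-- States `ξ_k = (x_k, x_{k-1})` of the generalized momentum method with stepsize `α` and
momentum parameters `β`, `ν`, started at `ξ₀ = (x_0, x_{-1})`, with additive gradient errors `w_k`:
`x_{k+1} = x_k - α (∇f(y_k) + w_k) + β (x_k - x_{k-1})`, `y_k = x_k + ν (x_k - x_{k-1})`.
Gradient descent is the case `β = ν = 0`. -/
def gmmState {d : ℕ} (f : EuclideanSpace ℝ (Fin d) → ℝ) (α β ν : ℝ)
    (ξ₀ : EuclideanSpace ℝ (Fin d) × EuclideanSpace ℝ (Fin d))
    (w : ℕ → EuclideanSpace ℝ (Fin d)) :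
    ℕ → EuclideanSpace ℝ (Fin d) × EuclideanSpace ℝ (Fin d)
  | 0 => ξ₀
  | k + 1 =>
    let ξ := gmmState f α β ν ξ₀ w k
    let y := ξ.1 + ν • (ξ.1 - ξ.2)
    (ξ.1 - α • (gradient f y + w k) + β • (ξ.1 - ξ.2), ξ.1)

/-- The system has `ℓ₂` gain at most `γ`, from the square-summable gradient errors `w` to the
output `z` with `‖z_k‖² = f(x_k) - f(x_*)`: there is a nonnegative function `H` of the
initialization, vanishing at `ξ_* = (x_*, x_*)`, such that
`∑ (f(x_k) - f(x_*)) ≤ γ² ∑ ‖w_k‖² + H(ξ₀)` (with a convergent left-hand side)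
for all initializations and all `w ∈ ℓ₂`. -/
def HasL2GainLE {d : ℕ} (f : EuclideanSpace ℝ (Fin d) → ℝ) (xs : EuclideanSpace ℝ (Fin d))
    (α β ν : ℝ) (γ : ℝ≥0) : Prop :=
  ∃ H : EuclideanSpace ℝ (Fin d) × EuclideanSpace ℝ (Fin d) → ℝ,
    (∀ ξ, 0 ≤ H ξ) ∧ H (xs, xs) = 0 ∧
    ∀ (ξ₀ : EuclideanSpace ℝ (Fin d) × EuclideanSpace ℝ (Fin d))
      (w : ℕ → EuclideanSpace ℝ (Fin d)), Summable (fun k => ‖w k‖ ^ 2) →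
      Summable (fun k => f (gmmState f α β ν ξ₀ w k).1 - f xs) ∧
      ∑' k, (f (gmmState f α β ν ξ₀ w k).1 - f xs) ≤
        (γ : ℝ) ^ 2 * ∑' k, ‖w k‖ ^ 2 + H ξ₀

/-- The `ℓ₂` gain `L_{2,*}`: the infimum of all `γ ≥ 0` such that the gain is at most `γ`
(it is `∞` if there is no such `γ`). -/
def l2Gain {d : ℕ} (f : EuclideanSpace ℝ (Fin d) → ℝ) (xs : EuclideanSpace ℝ (Fin d))
    (α β ν : ℝ) : ℝ≥0∞ :=
  ⨅ (γ : ℝ≥0) (_ : HasL2GainLE f xs α β ν γ), (γ : ℝ≥0∞)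

/-- The iteration matrix `A_Q` of the centered iterates, as a complex matrix. -/
def gmmA {d : ℕ} (Q : Matrix (Fin d) (Fin d) ℝ) (α β ν : ℝ) :
    Matrix (Fin d ⊕ Fin d) (Fin d ⊕ Fin d) ℂ :=
  (Matrix.fromBlocks ((1 + β) • 1 - (α * (1 + ν)) • Q) (-(β • 1) + (α * ν) • Q) 1 0).map
    Complex.ofReal

/-- The input matrix `B = [-α I; 0]`, as a complex matrix. -/
def gmmB (d : ℕ) (α : ℝ) : Matrix (Fin d ⊕ Fin d) (Fin d) ℂ :=
  (Matrix.fromRows (-(α • (1 : Matrix (Fin d) (Fin d) ℝ))) 0).map Complex.ofReal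

/-- The output matrix `T = [2^{-1/2} Λ^{1/2} Uᵀ, 0]`, where `Λ = diag(lam)`,
as a complex matrix. -/
def gmmT {d : ℕ} (U : Matrix (Fin d) (Fin d) ℝ) (lam : Fin d → ℝ) :
    Matrix (Fin d) (Fin d ⊕ Fin d) ℂ :=
  (Matrix.fromCols ((1 / √2) • (Matrix.diagonal (fun i => √(lam i)) * Uᵀ))
    (0 : Matrix (Fin d) (Fin d) ℝ)).map Complex.ofReal

/-- The transfer matrix `G(z) = T (z I - A_Q)⁻¹ B`. -/
def transferMatrix {d : ℕ} (Q U : Matrix (Fin d) (Fin d) ℝ) (lam : Fin d → ℝ) (α β ν : ℝ)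
    (z : ℂ) : Matrix (Fin d) (Fin d) ℂ :=
  gmmT U lam * (z • 1 - gmmA Q α β ν)⁻¹ * gmmB d α

/-- The spectral norm (Euclidean operator norm) `‖G(z)‖` of the transfer matrix. -/
def transferNorm {d : ℕ} (Q U : Matrix (Fin d) (Fin d) ℝ) (lam : Fin d → ℝ) (α β ν : ℝ)
    (z : ℂ) : ℝ :=
  ‖Matrix.toEuclideanCLM (n := Fin d) (𝕜 := ℂ) (transferMatrix Q U lam α β ν z)‖

/-- The `H_∞` norm of the system `(A_Q, B, T)`: the supremum of `‖G(z)‖` over the unit circle. -/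
def hInfNorm {d : ℕ} (Q U : Matrix (Fin d) (Fin d) ℝ) (lam : Fin d → ℝ) (α β ν : ℝ) : ℝ≥0∞ :=
  ⨆ z : Circle, ENNReal.ofReal (transferNorm Q U lam α β ν z)

/-- `b_λ = α λ (1 + ν) - (1 + β)`. -/
def gmmb (α β ν l : ℝ) : ℝ := α * l * (1 + ν) - (1 + β)

/-- `c_λ = β - α λ ν`. -/
def gmmc (α β ν l : ℝ) : ℝ := β - α * l * ν

end

/-! In the orthonormal eigenbasis of `Q`, gradient descent splits into scalar systems `u⁺ = a u - α
w` with `a = 1 - α λ` and output energy `λ / 2 * u ^ 2`; since `U` is orthogonal, the disturbance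
energy splits as well. Each mode has squared gain `λ α ^ 2 / (2 (1 - |a|) ^ 2)`. The upper bound on
the ℓ₂ gain comes from a quadratic storage function (`storage_dissipation`), the lower bound from
long constant or alternating disturbances along an eigenvector (`HasL2GainLE.mode_le`). In the
frequency domain the same number is the squared peak of the modal transfer function, reached at `z =
1` or `z = -1`. The modal gain falls in `λ` while `α λ ≤ 1` and grows afterwards, so only the
extreme eigenvalues count: both norms equal `gdGain`. They are computed separately, without
Parseval's identity. -/

/-! ### Calculus of the quadratic objective -/

theorem quadObjective_sub {d : ℕ} {Q : Matrix (Fin d) (Fin d) ℝ} (hQ : Qᵀ = Q)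
    (p : EuclideanSpace ℝ (Fin d)) (r : ℝ) (x y : EuclideanSpace ℝ (Fin d)) :
    quadObjective Q p r y - quadObjective Q p r x =
      (Q *ᵥ x.ofLp + p.ofLp) ⬝ᵥ (y - x).ofLp +
        1 / 2 * ((y - x).ofLp ⬝ᵥ (Q *ᵥ (y - x).ofLp)) := by
  have h : x.ofLp ⬝ᵥ (Q *ᵥ y.ofLp) = (Q *ᵥ x.ofLp) ⬝ᵥ y.ofLp := by
    rw [Matrix.dotProduct_mulVec, ← Matrix.mulVec_transpose, hQ]
  have h' : y.ofLp ⬝ᵥ (Q *ᵥ x.ofLp) = (Q *ᵥ x.ofLp) ⬝ᵥ y.ofLp := dotProduct_comm _ _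
  have h'' : x.ofLp ⬝ᵥ (Q *ᵥ x.ofLp) = (Q *ᵥ x.ofLp) ⬝ᵥ x.ofLp := dotProduct_comm _ _
  simp only [quadObjective, WithLp.ofLp_sub, Matrix.mulVec_sub, dotProduct_sub, sub_dotProduct,
    add_dotProduct, h, h', h'']
  ring

theorem hasGradientAt_quadObjective {d : ℕ} {Q : Matrix (Fin d) (Fin d) ℝ} (hQ : Qᵀ = Q)
    (p : EuclideanSpace ℝ (Fin d)) (r : ℝ) (x : EuclideanSpace ℝ (Fin d)) :
    HasGradientAt (quadObjective Q p r) (WithLp.toLp 2 (Q *ᵥ x.ofLp + p.ofLp)) x := by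
  let T := Matrix.toEuclideanCLM (n := Fin d) (𝕜 := ℝ) Q
  -- The expansion at `x` is exact, and its quadratic term has zero derivative at `x`.
  have hf : quadObjective Q p r = fun y => quadObjective Q p r x +
      inner ℝ (WithLp.toLp 2 (Q *ᵥ x.ofLp + p.ofLp)) (y - x) +
        1 / 2 * inner ℝ (T (y - x)) (y - x) := by
    funext y
    have := quadObjective_sub hQ p r x y
    rw [sub_eq_iff_eq_add] at this
    rw [this]
    simp only [EuclideanSpace.inner_eq_star_dotProduct, T, Matrix.ofLp_toEuclideanCLM,
      star_trivial]
    rw [dotProduct_comm (y - x).ofLp (Q *ᵥ x.ofLp + p.ofLp)]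
    ring
  rw [hf, hasGradientAt_iff_hasFDerivAt]
  have hid : HasFDerivAt (fun y : EuclideanSpace ℝ (Fin d) => y - x)
    (ContinuousLinearMap.id ℝ _) x := (hasFDerivAt_id x).sub_const x
  have h1 := (hasFDerivAt_const (WithLp.toLp 2 (Q *ᵥ x.ofLp + p.ofLp)) x).inner ℝ hid
  have h2 := (((T.hasFDerivAt.comp x hid).inner ℝ hid).const_mul (1 / 2 : ℝ))
  refine ((h1.const_add (quadObjective Q p r x)).add h2).congr_fderiv ?_
  ext v
  simp [inner_add_left]

theorem mulVec_minimizer {d : ℕ} {Q : Matrix (Fin d) (Fin d) ℝ} (hQ : Qᵀ = Q)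
    {p : EuclideanSpace ℝ (Fin d)} {r : ℝ} {xs : EuclideanSpace ℝ (Fin d)}
    (hxs : ∀ x, quadObjective Q p r xs ≤ quadObjective Q p r x) :
    Q *ᵥ xs.ofLp + p.ofLp = 0 := by
  have hmin : IsLocalMin (quadObjective Q p r) xs := Eventually.of_forall hxs
  have h := hmin.hasFDerivAt_eq_zero (hasGradientAt_quadObjective hQ p r xs).hasFDerivAt
  rw [EmbeddingLike.map_eq_zero_iff] at h
  simpa using congrArg WithLp.ofLp h

/-- The coordinates of `x - xs` in the orthonormal basis given by the columns of `U`. -/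
def modalCoord {d : ℕ} (U : Matrix (Fin d) (Fin d) ℝ) (xs x : EuclideanSpace ℝ (Fin d)) :
    Fin d → ℝ :=
  Uᵀ *ᵥ (x - xs).ofLp

theorem sum_sq_transpose_mulVec {d : ℕ} {U : Matrix (Fin d) (Fin d) ℝ} (hU : U * Uᵀ = 1)
    (w : EuclideanSpace ℝ (Fin d)) : ∑ i, (Uᵀ *ᵥ w.ofLp) i ^ 2 = ‖w‖ ^ 2 := by
  have h : (Uᵀ *ᵥ w.ofLp) ⬝ᵥ (Uᵀ *ᵥ w.ofLp) = w.ofLp ⬝ᵥ w.ofLp := by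
    rw [Matrix.dotProduct_mulVec, ← Matrix.mulVec_transpose, Matrix.transpose_transpose,
      Matrix.mulVec_mulVec, hU, Matrix.one_mulVec]
  rw [EuclideanSpace.real_norm_sq_eq]
  simpa [dotProduct, sq] using h

/-! ### Decoupling into scalar modes -/

section Modes

variable {d : ℕ} {Q : Matrix (Fin d) (Fin d) ℝ} {p : EuclideanSpace ℝ (Fin d)} {r : ℝ}
  {xs : EuclideanSpace ℝ (Fin d)} {U : Matrix (Fin d) (Fin d) ℝ} {lam : Fin d → ℝ}

theorem transpose_eq_self_of_decomp (hdec : Q = U * Matrix.diagonal lam * Uᵀ) : Qᵀ = Q := by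
  rw [hdec]
  simp [Matrix.transpose_mul, Matrix.mul_assoc]

theorem transpose_mulVec_mulVec_of_decomp (hU : Uᵀ * U = 1)
    (hdec : Q = U * Matrix.diagonal lam * Uᵀ) (v : Fin d → ℝ) (i : Fin d) :
    (Uᵀ *ᵥ (Q *ᵥ v)) i = lam i * (Uᵀ *ᵥ v) i := by
  have : Uᵀ *ᵥ (Q *ᵥ v) = Matrix.diagonal lam *ᵥ (Uᵀ *ᵥ v) := by
    simp only [Matrix.mulVec_mulVec]
    rw [hdec, ← Matrix.mul_assoc, ← Matrix.mul_assoc, hU, Matrix.one_mul]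
  rw [this, Matrix.mulVec_diagonal]

theorem quadObjective_sub_minimizer
    (hdec : Q = U * Matrix.diagonal lam * Uᵀ)
    (hxs : ∀ x, quadObjective Q p r xs ≤ quadObjective Q p r x)
    (x : EuclideanSpace ℝ (Fin d)) :
    quadObjective Q p r x - quadObjective Q p r xs =
      ∑ i, lam i / 2 * modalCoord U xs x i ^ 2 := by
  have hQ := transpose_eq_self_of_decomp hdec
  rw [quadObjective_sub hQ, mulVec_minimizer hQ hxs, zero_dotProduct, zero_add]
  have h : (x - xs).ofLp ⬝ᵥ (Q *ᵥ (x - xs).ofLp) =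
      modalCoord U xs x ⬝ᵥ (Matrix.diagonal lam *ᵥ modalCoord U xs x) := by
    rw [hdec, ← Matrix.mulVec_mulVec, ← Matrix.mulVec_mulVec, Matrix.dotProduct_mulVec,
      ← Matrix.mulVec_transpose]
    rfl
  rw [h, dotProduct, Finset.mul_sum]
  refine Finset.sum_congr rfl fun i _ => ?_
  rw [Matrix.mulVec_diagonal]
  ring

theorem modalCoord_gmmState_succ (hU : Uᵀ * U = 1)
    (hdec : Q = U * Matrix.diagonal lam * Uᵀ)
    (hxs : ∀ x, quadObjective Q p r xs ≤ quadObjective Q p r x) (α : ℝ)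
    (ξ₀ : EuclideanSpace ℝ (Fin d) × EuclideanSpace ℝ (Fin d))
    (w : ℕ → EuclideanSpace ℝ (Fin d)) (k : ℕ) (i : Fin d) :
    modalCoord U xs (gmmState (quadObjective Q p r) α 0 0 ξ₀ w (k + 1)).1 i =
      (1 - α * lam i) * modalCoord U xs (gmmState (quadObjective Q p r) α 0 0 ξ₀ w k).1 i -
        α * (Uᵀ *ᵥ (w k).ofLp) i := by
  have hQ := transpose_eq_self_of_decomp hdec
  set x := (gmmState (quadObjective Q p r) α 0 0 ξ₀ w k).1 with hx
  have hstep : (gmmState (quadObjective Q p r) α 0 0 ξ₀ w (k + 1)).1 =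
      x - α • (WithLp.toLp 2 (Q *ᵥ x.ofLp + p.ofLp) + w k) := by
    simp only [gmmState, ← hx, zero_smul, add_zero]
    rw [(hasGradientAt_quadObjective hQ p r x).gradient]
  have hp : p.ofLp = -(Q *ᵥ xs.ofLp) := by
    rw [eq_neg_iff_add_eq_zero, add_comm]; exact mulVec_minimizer hQ hxs
  have hvec : (x - α • (WithLp.toLp 2 (Q *ᵥ x.ofLp + p.ofLp) + w k) - xs).ofLp =
      (x - xs).ofLp - α • (Q *ᵥ (x - xs).ofLp) - α • (w k).ofLp := by
    rw [hp]
    simp only [WithLp.ofLp_sub, WithLp.ofLp_smul, WithLp.ofLp_add, Matrix.mulVec_sub]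
    module
  rw [hstep]
  simp only [modalCoord]
  rw [hvec]
  simp only [Matrix.mulVec_sub, Matrix.mulVec_smul, Pi.sub_apply, Pi.smul_apply, smul_eq_mul]
  have := transpose_mulVec_mulVec_of_decomp hU hdec (x - xs).ofLp i
  linear_combination (-α) * this

end Modes

/-! ### Scalar estimates -/

/-- Convexity of the square with weights `|a|` and `t = 1 - |a|`, at the points `|u|` and `|α w| /
t`, bounds the squared new state. The storage weight `l / (2 t)` is chosen so that the contraction
from `u ^ 2` to `|a| u ^ 2` releases exactly `l / 2 * u ^ 2`. -/
theorem storage_dissipation {α l a g u w : ℝ} (ha : |a| < 1) (hl : 0 ≤ l)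
    (hg : l * α ^ 2 / (2 * (1 - |a|) ^ 2) ≤ g) :
    l / 2 * u ^ 2 ≤ l / (2 * (1 - |a|)) * u ^ 2 -
      l / (2 * (1 - |a|)) * (a * u - α * w) ^ 2 + g * w ^ 2 := by
  set t := 1 - |a| with ht
  have ht0 : 0 < t := by linarith
  have hP : 0 ≤ l / (2 * t) := by positivity
  have key : (a * u - α * w) ^ 2 ≤ |a| * u ^ 2 + α ^ 2 * w ^ 2 / t := by
    have h1 : (a * u - α * w) ^ 2 ≤ (|a| * |u| + |α * w|) ^ 2 := by
      rw [← sq_abs (a * u - α * w), ← abs_mul]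
      gcongr
      exact abs_sub _ _
    have h2 : (|a| * |u| + |α * w|) ^ 2 =
        |a| * |u| ^ 2 + |α * w| ^ 2 / t - |a| * t * (|u| - |α * w| / t) ^ 2 := by
      have : |a| = 1 - t := by linarith
      rw [this]
      field_simp
      ring
    rw [sq_abs, sq_abs, mul_pow] at h2
    have h3 : 0 ≤ |a| * t * (|u| - |α * w| / t) ^ 2 := by positivity
    linarith
  have h4 := mul_le_mul_of_nonneg_left key hP
  have h5 : l / (2 * t) * (|a| * u ^ 2 + α ^ 2 * w ^ 2 / t) =
      l / (2 * t) * u ^ 2 - l / 2 * u ^ 2 + l * α ^ 2 / (2 * t ^ 2) * w ^ 2 := by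
    have : |a| = 1 - t := by linarith
    rw [this]
    field_simp
  have h6 := mul_le_mul_of_nonneg_right hg (sq_nonneg w)
  linarith

theorem tendsto_affine_recursion {a c : ℝ} (ha : |a| < 1) {v : ℕ → ℝ}
    (hv : ∀ k, v (k + 1) = c + a * v k) : Tendsto v atTop (𝓝 (c / (1 - a))) := by
  have h1a : 1 - a ≠ 0 := by linarith [(abs_lt.mp ha).2]
  have h : v = fun k => c / (1 - a) + a ^ k * (v 0 - c / (1 - a)) := by
    funext k
    induction k with
    | zero => simp
    | succ k ih => rw [hv, ih]; field_simp; ring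
  rw [h]
  simpa using ((tendsto_pow_atTop_nhds_zero_of_abs_lt_one ha).mul_const
    (v 0 - c / (1 - a))).const_add (c / (1 - a))

/-- Cesàro means inherit the limit; this turns a bound on total energy over `N` steps into one on
the steady state. -/
theorem le_of_sum_range_le {u : ℕ → ℝ} {l c : ℝ} (hu : Tendsto u atTop (𝓝 l))
    (h : ∀ N : ℕ, ∑ k ∈ Finset.range N, u k ≤ c * N) : l ≤ c := by
  refine le_of_tendsto hu.cesaro (eventually_atTop.mpr ⟨1, fun N hN => ?_⟩)
  have hN' : (0 : ℝ) < N := by exact_mod_cast hN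
  rw [inv_mul_le_iff₀ hN', mul_comm]
  exact h N

/-! ### Upper and lower bounds on the ℓ₂ gain -/

section Gain

variable {d : ℕ} {Q : Matrix (Fin d) (Fin d) ℝ} {p : EuclideanSpace ℝ (Fin d)} {r : ℝ}
  {xs : EuclideanSpace ℝ (Fin d)} {U : Matrix (Fin d) (Fin d) ℝ} {lam : Fin d → ℝ}

/-- The modal storage functions add up to `V`, the dissipation inequality telescopes, and `V` at the
initial point serves as `H`. -/
theorem hasL2GainLE_of_modes (hU : Uᵀ * U = 1)
    (hdec : Q = U * Matrix.diagonal lam * Uᵀ)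
    (hxs : ∀ x, quadObjective Q p r xs ≤ quadObjective Q p r x) {α : ℝ}
    (hlam : ∀ i, 0 ≤ lam i) (hα : ∀ i, |1 - α * lam i| < 1) {γ : ℝ≥0}
    (hγ : ∀ i, lam i * α ^ 2 / (2 * (1 - |1 - α * lam i|) ^ 2) ≤ (γ : ℝ) ^ 2) :
    HasL2GainLE (quadObjective Q p r) xs α 0 0 γ := by
  set V : EuclideanSpace ℝ (Fin d) → ℝ := fun x =>
    ∑ i, lam i / (2 * (1 - |1 - α * lam i|)) * modalCoord U xs x i ^ 2 with hV
  have hV0 : ∀ x, 0 ≤ V x := fun x => Finset.sum_nonneg fun i _ => by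
    have := hlam i
    have : 0 < 1 - |1 - α * lam i| := by linarith [hα i]
    positivity
  refine ⟨fun ξ => V ξ.1, fun ξ => hV0 _, by simp [hV, modalCoord], fun ξ₀ w hw => ?_⟩
  set x : ℕ → EuclideanSpace ℝ (Fin d) :=
    fun k => (gmmState (quadObjective Q p r) α 0 0 ξ₀ w k).1 with hx
  have hstep : ∀ k, quadObjective Q p r (x k) - quadObjective Q p r xs ≤
      (γ : ℝ) ^ 2 * ‖w k‖ ^ 2 + (V (x k) - V (x (k + 1))) := by
    intro k
    rw [quadObjective_sub_minimizer hdec hxs,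
      ← sum_sq_transpose_mulVec (mul_eq_one_comm.mp hU) (w k), Finset.mul_sum]
    simp only [hV]
    rw [← Finset.sum_sub_distrib, ← Finset.sum_add_distrib]
    refine Finset.sum_le_sum fun i _ => ?_
    have h := storage_dissipation (u := modalCoord U xs (x k) i)
      (w := (Uᵀ *ᵥ (w k).ofLp) i) (hα i) (hlam i) (hγ i)
    rw [← modalCoord_gmmState_succ hU hdec hxs α ξ₀ w k i] at h
    simp only [hx] at h ⊢
    linarith
  have hpart : ∀ N, ∑ k ∈ Finset.range N, (quadObjective Q p r (x k) - quadObjective Q p r xs) ≤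
      (γ : ℝ) ^ 2 * ∑' k, ‖w k‖ ^ 2 + V ξ₀.1 := by
    intro N
    have h1 := Finset.sum_le_sum fun k (_ : k ∈ Finset.range N) => hstep k
    rw [Finset.sum_add_distrib, Finset.sum_range_sub', ← Finset.mul_sum] at h1
    have h2 := mul_le_mul_of_nonneg_left
      (hw.sum_le_tsum (Finset.range N) fun k _ => sq_nonneg _) (sq_nonneg (γ : ℝ))
    have h3 := hV0 (x N)
    have h4 : V (x 0) = V ξ₀.1 := rfl
    linarith
  have hnn : ∀ k, 0 ≤ quadObjective Q p r (x k) - quadObjective Q p r xs :=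
    fun k => sub_nonneg.mpr (hxs _)
  exact ⟨summable_of_sum_range_le hnn hpart, Real.tsum_le_of_sum_range_le hnn hpart⟩

/-- Starting at equilibrium removes `H`. The disturbance `s ^ k • e` along the eigenvector `e`,
switched off after `N` steps, has energy `N`, while the mode approaches amplitude `α / (1 - s a)` in
modulus. -/
theorem HasL2GainLE.mode_le (hU : Uᵀ * U = 1)
    (hdec : Q = U * Matrix.diagonal lam * Uᵀ)
    (hxs : ∀ x, quadObjective Q p r xs ≤ quadObjective Q p r x) {α : ℝ}
    (hlam : ∀ i, 0 ≤ lam i) {γ : ℝ≥0}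
    (h : HasL2GainLE (quadObjective Q p r) xs α 0 0 γ) (i : Fin d)
    (hα : |1 - α * lam i| < 1) {s : ℝ} (hs : s ^ 2 = 1) :
    lam i / 2 * (α / (1 - s * (1 - α * lam i))) ^ 2 ≤ (γ : ℝ) ^ 2 := by
  obtain ⟨H, -, hH0, hH⟩ := h
  set a := 1 - α * lam i with ha
  -- The modal response with the sign `-s ^ (k + 1)` factored out, so that it converges even when `s
  -- = -1`.
  let v : ℕ → ℝ := fun k => Nat.rec 0 (fun _ y => α + s * a * y) k
  have hv : ∀ k, v (k + 1) = α + s * a * v k := fun k => rfl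
  have hsa : |s * a| < 1 := by
    have : |s| = 1 := by
      rw [← sq_abs] at hs
      nlinarith [abs_nonneg s]
    rwa [abs_mul, this, one_mul]
  refine le_of_sum_range_le (u := fun k => lam i / 2 * v k ^ 2)
    (((tendsto_affine_recursion hsa hv).pow 2).const_mul _) fun N => ?_
  set e : EuclideanSpace ℝ (Fin d) := WithLp.toLp 2 (U *ᵥ Pi.single i 1) with he
  have hUe : Uᵀ *ᵥ e.ofLp = Pi.single i 1 := by
    simp only [he, Matrix.mulVec_mulVec, hU, Matrix.one_mulVec]
  have hne : ‖e‖ ^ 2 = 1 := by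
    rw [← sum_sq_transpose_mulVec (mul_eq_one_comm.mp hU) e, hUe]
    rw [Finset.sum_eq_single i] <;> simp +contextual
  set w : ℕ → EuclideanSpace ℝ (Fin d) := fun k => if k < N then s ^ k • e else 0 with hw
  have hwn : ∀ k, ‖w k‖ ^ 2 = if k < N then 1 else 0 := by
    intro k
    simp only [hw]
    split_ifs
    · rw [norm_smul, mul_pow, hne, Real.norm_eq_abs, sq_abs, ← pow_mul, mul_comm k, pow_mul, hs]
      simp
    · simp
  have hwsum : HasSum (fun k => ‖w k‖ ^ 2) (N : ℝ) := by
    simp only [hwn]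
    have h := hasSum_sum_of_ne_finset_zero (L := .unconditional ℕ)
      (f := fun k => if k < N then (1 : ℝ) else 0) (s := Finset.range N)
      fun k hk => if_neg (by simpa using hk)
    rwa [Finset.sum_congr rfl fun k hk => if_pos (Finset.mem_range.mp hk), Finset.sum_const,
      Finset.card_range, nsmul_one] at h
  obtain ⟨h1, h2⟩ := hH (xs, xs) w hwsum.summable
  rw [hwsum.tsum_eq, hH0, add_zero] at h2
  refine le_trans (le_trans (Finset.sum_le_sum fun k hk => ?_)
    (h1.sum_le_tsum (Finset.range N) fun k _ => sub_nonneg.mpr (hxs _))) h2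
  have hcoord : ∀ k, k ≤ N → modalCoord U xs
      (gmmState (quadObjective Q p r) α 0 0 (xs, xs) w k).1 i = -(s ^ (k + 1) * v k) := by
    intro k
    induction k with
    | zero => intro _; simp [gmmState, modalCoord, v]
    | succ k ih =>
      intro hk
      rw [modalCoord_gmmState_succ hU hdec hxs, ih (by omega), ← ha, hv]
      simp only [hw, if_pos (show k < N by omega), WithLp.ofLp_smul, Matrix.mulVec_smul, hUe,
        Pi.smul_apply, Pi.single_eq_same, smul_eq_mul]
      linear_combination (s ^ k * α + s ^ (k + 1) * a * v k) * hs
  have hsq : v k ^ 2 = modalCoord U xs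
      (gmmState (quadObjective Q p r) α 0 0 (xs, xs) w k).1 i ^ 2 := by
    rw [hcoord k (Finset.mem_range.mp hk).le, neg_sq, mul_pow, ← pow_mul, mul_comm (k + 1),
      pow_mul, hs, one_pow, one_mul]
  rw [quadObjective_sub_minimizer hdec hxs, hsq]
  -- All modes but `i` are dropped from the objective gap.
  exact Finset.single_le_sum (f := fun j => lam j / 2 * modalCoord U xs
      (gmmState (quadObjective Q p r) α 0 0 (xs, xs) w k).1 j ^ 2)
    (fun j _ => mul_nonneg (div_nonneg (hlam j) zero_le_two) (sq_nonneg _)) (Finset.mem_univ i)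

end Gain

/-! ### Spectrum and transfer matrix -/

section Transfer

variable {d : ℕ} {Q U : Matrix (Fin d) (Fin d) ℝ} {lam : Fin d → ℝ}

theorem map_ofReal_transpose_mul_self (hU : Uᵀ * U = 1) :
    (U.map Complex.ofReal)ᵀ * U.map Complex.ofReal = 1 := by
  have := congrArg (fun M => M.map Complex.ofRealHom) hU
  rwa [Matrix.map_mul, Matrix.map_one _ (map_zero _) (map_one _)] at this

/-- Without momentum the pencil is block lower triangular, which makes its determinant and inverse
explicit. -/
theorem smul_one_sub_gmmA (Q : Matrix (Fin d) (Fin d) ℝ) (α : ℝ) (z : ℂ) :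
    z • 1 - gmmA Q α 0 0 =
      Matrix.fromBlocks (z • 1 - (1 - (α : ℂ) • Q.map Complex.ofReal)) 0 (-1) (z • 1) := by
  rw [← Matrix.fromBlocks_one, Matrix.fromBlocks_smul]
  ext (i | i) (j | j) <;> by_cases h : i = j <;> simp [gmmA, h]

theorem smul_one_sub_decomp (hU : Uᵀ * U = 1) (hdec : Q = U * Matrix.diagonal lam * Uᵀ)
    (α : ℝ) (z : ℂ) :
    z • 1 - (1 - (α : ℂ) • Q.map Complex.ofReal) =
      U.map Complex.ofReal * Matrix.diagonal (fun i => z - ((1 - α * lam i : ℝ) : ℂ)) *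
        (U.map Complex.ofReal)ᵀ := by
  have hQ : Q.map Complex.ofReal = U.map Complex.ofReal *
      Matrix.diagonal (fun i => (lam i : ℂ)) * (U.map Complex.ofReal)ᵀ := by
    have := congrArg (fun M => M.map Complex.ofRealHom) hdec
    rwa [Matrix.map_mul, Matrix.map_mul, Matrix.diagonal_map (map_zero _)] at this
  have hD : Matrix.diagonal (fun i => z - ((1 - α * lam i : ℝ) : ℂ)) =
      (z - 1) • (1 : Matrix (Fin d) (Fin d) ℂ) +
        (α : ℂ) • Matrix.diagonal (fun i => (lam i : ℂ)) := by
    ext i j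
    by_cases h : i = j
    · subst h; simp; ring
    · simp [h]
  have hUU := mul_eq_one_comm.mp (map_ofReal_transpose_mul_self hU)
  rw [hD, hQ, Matrix.mul_add, Matrix.add_mul, Matrix.mul_smul, Matrix.smul_mul, Matrix.mul_one,
    hUU, Matrix.mul_smul, Matrix.smul_mul]
  module

theorem det_smul_one_sub_gmmA (hU : Uᵀ * U = 1) (hdec : Q = U * Matrix.diagonal lam * Uᵀ)
    (α : ℝ) (z : ℂ) :
    (z • 1 - gmmA Q α 0 0).det = (∏ i, (z - ((1 - α * lam i : ℝ) : ℂ))) * z ^ d := by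
  rw [smul_one_sub_gmmA, Matrix.det_fromBlocks_zero₁₂, smul_one_sub_decomp hU hdec,
    Matrix.det_mul_right_comm, mul_eq_one_comm.mp (map_ofReal_transpose_mul_self hU),
    Matrix.one_mul, Matrix.det_diagonal, Matrix.det_smul]
  simp

theorem mem_spectrum_gmmA_iff (hU : Uᵀ * U = 1) (hdec : Q = U * Matrix.diagonal lam * Uᵀ)
    (hd : d ≠ 0) (α : ℝ) (z : ℂ) :
    z ∈ spectrum ℂ (gmmA Q α 0 0) ↔ z = 0 ∨ ∃ i, z = ((1 - α * lam i : ℝ) : ℂ) := by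
  rw [spectrum.mem_iff, Algebra.algebraMap_eq_smul_one, Matrix.isUnit_iff_isUnit_det,
    isUnit_iff_ne_zero, not_not, det_smul_one_sub_gmmA hU hdec, mul_eq_zero,
    Finset.prod_eq_zero_iff, pow_eq_zero_iff hd, or_comm]
  simp [sub_eq_zero]

theorem spectralRadius_gmmA_lt_one_iff (hU : Uᵀ * U = 1)
    (hdec : Q = U * Matrix.diagonal lam * Uᵀ) (hd : d ≠ 0) (α : ℝ) :
    spectralRadius ℂ (gmmA Q α 0 0) < 1 ↔ ∀ i, |1 - α * lam i| < 1 := by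
  constructor
  · intro h i
    have h1 : (‖((1 - α * lam i : ℝ) : ℂ)‖₊ : ℝ≥0∞) ≤ spectralRadius ℂ (gmmA Q α 0 0) :=
      le_iSup₂ (f := fun (k : ℂ) (_ : k ∈ spectrum ℂ (gmmA Q α 0 0)) => (‖k‖₊ : ℝ≥0∞)) _
        ((mem_spectrum_gmmA_iff hU hdec hd α _).mpr (Or.inr ⟨i, rfl⟩))
    have h2 := h1.trans_lt h
    rw [← ENNReal.coe_one, ENNReal.coe_lt_coe, ← NNReal.coe_lt_coe, coe_nnnorm,
      Complex.norm_real, Real.norm_eq_abs] at h2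
    exact h2
  · intro h
    -- The spectral radius is a supremum, so strictness needs a uniform bound; finiteness of the
    -- index set supplies it.
    obtain ⟨c, hc1, hc⟩ : ∃ c : ℝ≥0, c < 1 ∧ ∀ i, |1 - α * lam i| ≤ c := by
      refine ⟨Finset.univ.sup fun i => ‖1 - α * lam i‖₊, ?_, fun i => ?_⟩
      · rw [Finset.sup_lt_iff (by simp)]
        intro i _
        exact_mod_cast h i
      · exact_mod_cast Finset.le_sup (f := fun i => ‖1 - α * lam i‖₊) (Finset.mem_univ i)
    refine lt_of_le_of_lt (b := (c : ℝ≥0∞)) (iSup₂_le fun z hz => ?_) (by exact_mod_cast hc1)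
    rw [ENNReal.coe_le_coe, ← NNReal.coe_le_coe, coe_nnnorm]
    rcases (mem_spectrum_gmmA_iff hU hdec hd α z).mp hz with rfl | ⟨i, rfl⟩
    · simp
    · rw [Complex.norm_real, Real.norm_eq_abs]; exact hc i

/-- The diagonal entries of the transfer matrix of gradient descent in modal coordinates. -/
noncomputable def modalTransfer (lam : Fin d → ℝ) (α : ℝ) (z : ℂ) (i : Fin d) : ℂ :=
  ((-(√(lam i) / √2 * α) : ℝ) : ℂ) / (z - ((1 - α * lam i : ℝ) : ℂ))

/-- The `Uᵀ` in the output matrix cancels the left `U` of the resolvent; the `Uᵀ` left on the right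
is unitary and does not affect the norm. -/
theorem transferMatrix_eq (hU : Uᵀ * U = 1) (hdec : Q = U * Matrix.diagonal lam * Uᵀ)
    {α : ℝ} {z : ℂ} (hz0 : z ≠ 0) (hz : ∀ i, z ≠ ((1 - α * lam i : ℝ) : ℂ)) :
    transferMatrix Q U lam α 0 0 z =
      Matrix.diagonal (modalTransfer lam α z) * (U.map Complex.ofReal)ᵀ := by
  set W := U.map Complex.ofReal with hW
  have hWW : Wᵀ * W = 1 := map_ofReal_transpose_mul_self hU
  set D : Fin d → ℂ := fun i => z - ((1 - α * lam i : ℝ) : ℂ) with hD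
  have hD0 : ∀ i, D i ≠ 0 := fun i => sub_ne_zero.mpr (hz i)
  set M : Matrix (Fin d) (Fin d) ℂ := W * Matrix.diagonal (fun i => (D i)⁻¹) * Wᵀ with hM
  have hinv : (z • 1 - gmmA Q α 0 0)⁻¹ =
      Matrix.fromBlocks M 0 (z⁻¹ • M) (z⁻¹ • 1) := by
    apply Matrix.inv_eq_left_inv
    have hMD : M * (W * Matrix.diagonal D * Wᵀ) = 1 := by
      have : M * (W * Matrix.diagonal D * Wᵀ) =
          W * (Matrix.diagonal (fun i => (D i)⁻¹) * (Wᵀ * W) * Matrix.diagonal D) * Wᵀ := by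
        simp only [hM, Matrix.mul_assoc]
      rw [this, hWW, Matrix.mul_one, Matrix.diagonal_mul_diagonal]
      simp only [inv_mul_cancel₀ (hD0 _), Matrix.diagonal_one, Matrix.mul_one]
      exact mul_eq_one_comm.mp hWW
    rw [smul_one_sub_gmmA, smul_one_sub_decomp hU hdec, Matrix.fromBlocks_multiply,
      Matrix.smul_mul, hMD, ← Matrix.fromBlocks_one]
    congr 1 <;> simp [hz0]
  have hB : gmmB d α = Matrix.fromRows (-((α : ℂ) • 1)) 0 := by
    ext (i | i) j <;> by_cases h : i = j <;> simp [gmmB, h]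
  have hT : gmmT U lam =
      Matrix.fromCols (Matrix.diagonal (fun i => ((√(lam i) / √2 : ℝ) : ℂ)) * Wᵀ) 0 := by
    ext i (j | j) <;> simp [gmmT, hW, Matrix.diagonal_mul]
    ring
  rw [transferMatrix, hinv, hB, hT, Matrix.fromCols_mul_fromBlocks,
    Matrix.fromCols_mul_fromRows]
  simp only [Matrix.zero_mul, Matrix.mul_zero, smul_zero, add_zero, Matrix.mul_neg, Matrix.mul_smul,
    Matrix.mul_one]
  have : Matrix.diagonal (fun i => ((√(lam i) / √2 : ℝ) : ℂ)) * Wᵀ * M =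
      Matrix.diagonal (fun i => ((√(lam i) / √2 : ℝ) : ℂ)) * (Wᵀ * W) *
        Matrix.diagonal (fun i => (D i)⁻¹) * Wᵀ := by
    simp only [hM, Matrix.mul_assoc]
  rw [this, hWW, Matrix.mul_one, Matrix.diagonal_mul_diagonal, ← Matrix.smul_mul,
    ← Matrix.neg_mul]
  congr 1
  ext i j
  by_cases h : i = j
  · subst h
    simp [modalTransfer, hD]
    ring
  · simp [h]

open scoped Matrix.Norms.L2Operator in
theorem transferNorm_eq (hU : Uᵀ * U = 1) (hdec : Q = U * Matrix.diagonal lam * Uᵀ)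
    {α : ℝ} {z : ℂ} (hz0 : z ≠ 0) (hz : ∀ i, z ≠ ((1 - α * lam i : ℝ) : ℂ)) :
    transferNorm Q U lam α 0 0 z = ‖modalTransfer lam α z‖ := by
  have hW : (U.map Complex.ofReal)ᵀ ∈ unitary (Matrix (Fin d) (Fin d) ℂ) := by
    have hs : star (U.map Complex.ofReal)ᵀ = U.map Complex.ofReal := by
      ext i j; simp [Matrix.star_apply]
    have h := map_ofReal_transpose_mul_self hU
    rw [Unitary.mem_iff, hs]
    exact ⟨mul_eq_one_comm.mp h, h⟩
  rw [transferNorm, transferMatrix_eq hU hdec hz0 hz, Matrix.l2_opNorm_toEuclideanCLM,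
    CStarRing.norm_mul_mem_unitary _ hW, Matrix.l2_opNorm_diagonal]

end Transfer

/-- The `ℓ₂` gain of gradient descent with stepsize `α` on a quadratic whose eigenvalues have
minimum `μ` and maximum `L`. -/
noncomputable def gdGain (μ L α : ℝ) : ℝ :=
  max (1 / √(2 * μ)) (α * √L / (√2 * (2 - α * L)))

/-! ### The closed form of the gain -/

theorem gdGain_nonneg (μ L α : ℝ) : 0 ≤ gdGain μ L α :=
  le_max_of_le_left (by positivity)

/-- Puts the first branch in the shape of the modal bound with `s = 1`; `sqrt_div_sq` does the same
for the second with `s = -1`. -/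
theorem one_div_sqrt_sq {μ α : ℝ} (hμ : 0 < μ) (hα : 0 < α) :
    (1 / √(2 * μ)) ^ 2 = μ / 2 * (α / (1 - 1 * (1 - α * μ))) ^ 2 := by
  rw [div_pow, Real.sq_sqrt (by positivity)]
  have : 1 - 1 * (1 - α * μ) = α * μ := by ring
  rw [this]
  field_simp

theorem sqrt_div_sq {L : ℝ} (hL : 0 ≤ L) (α : ℝ) :
    (α * √L / (√2 * (2 - α * L))) ^ 2 = L / 2 * (α / (1 - -1 * (1 - α * L))) ^ 2 := by
  have : 1 - -1 * (1 - α * L) = 2 - α * L := by ring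
  rw [this, div_pow, mul_pow, mul_pow, Real.sq_sqrt hL, Real.sq_sqrt zero_le_two, div_pow,
    div_mul_div_comm, mul_comm L]

/-- For `α l ≤ 1` the modal gain is decreasing in `l`, so `μ` dominates; for `α l ≥ 1` it is
increasing, so `L` does. -/
theorem mode_gain_le_gdGain_sq {μ L α l : ℝ} (hμ : 0 < μ) (hα : 0 < α) (hαL : α * L < 2)
    (hμl : μ ≤ l) (hlL : l ≤ L) :
    l * α ^ 2 / (2 * (1 - |1 - α * l|) ^ 2) ≤ gdGain μ L α ^ 2 := by
  have hl : 0 < l := hμ.trans_le hμl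
  have hL : 0 < L := hl.trans_le hlL
  have hD : 0 < 2 - α * L := by linarith
  rcases le_total 0 (1 - α * l) with h | h
  · have h1 : l * α ^ 2 / (2 * (1 - |1 - α * l|) ^ 2) = (1 / √(2 * l)) ^ 2 := by
      rw [abs_of_nonneg h, one_div_sqrt_sq hl hα, one_mul]
      ring
    rw [h1]
    refine pow_le_pow_left₀ (by positivity) ((?_ : _ ≤ 1 / √(2 * μ)).trans (le_max_left _ _)) 2
    gcongr
  · have h1 : l * α ^ 2 / (2 * (1 - |1 - α * l|) ^ 2) =
        (α * √l / (√2 * (2 - α * l))) ^ 2 := by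
      rw [abs_of_nonpos h, sqrt_div_sq hl.le, neg_one_mul, div_pow, div_mul_div_comm]
    have hd : 0 < 2 - α * l := by nlinarith
    rw [h1]
    refine pow_le_pow_left₀ (by positivity)
      ((?_ : _ ≤ α * √L / (√2 * (2 - α * L))).trans (le_max_right _ _)) 2
    gcongr

theorem sqrt_div_le_iff {μ L α : ℝ} (hμ : 0 < μ) (hL : 0 < L) (hαL : α < 2 / L) :
    α * √L / (√2 * (2 - α * L)) ≤ 1 / √(2 * μ) ↔ α ≤ 2 / (L + √(L * μ)) := by
  have hD : 0 < 2 - α * L := by rw [lt_div_iff₀ hL] at hαL; linarith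
  rw [Real.sqrt_mul zero_le_two, Real.sqrt_mul hL.le, div_le_div_iff₀ (by positivity)
    (by positivity), le_div_iff₀ (by positivity)]
  have h2 : 0 < √2 := by positivity
  have : α * √L * (√2 * √μ) = √2 * (α * √L * √μ) := by ring
  rw [this, one_mul, mul_le_mul_iff_right₀ h2]
  constructor <;> intro h <;> linarith

theorem gdGain_of_le {μ L α : ℝ} (hμ : 0 < μ) (hL : 0 < L)
    (hα : α ≤ 2 / (L + √(L * μ))) (hαL : α < 2 / L) : gdGain μ L α = 1 / √(2 * μ) :=
  max_eq_left ((sqrt_div_le_iff hμ hL hαL).mpr hα)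

theorem gdGain_of_lt {μ L α : ℝ} (hμ : 0 < μ) (hL : 0 < L)
    (hα : 2 / (L + √(L * μ)) < α) (hαL : α < 2 / L) :
    gdGain μ L α = α * √L / (√2 * (2 - α * L)) :=
  max_eq_right (le_of_not_ge fun h => hα.not_ge ((sqrt_div_le_iff hμ hL hαL).mp h))

theorem tendsto_gdGain {μ L : ℝ} (hL : 0 < L) :
    Tendsto (gdGain μ L) (𝓝[<] (2 / L)) atTop := by
  refine tendsto_atTop_mono (fun α => le_max_right _ _) ?_
  have hden : Tendsto (fun α : ℝ => √2 * (2 - α * L)) (𝓝[<] (2 / L)) (𝓝[>] 0) := by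
    refine tendsto_nhdsWithin_iff.mpr ⟨?_, ?_⟩
    · have : Continuous fun α : ℝ => √2 * (2 - α * L) := by fun_prop
      have h := this.tendsto (2 / L)
      rw [div_mul_cancel₀ _ hL.ne', sub_self, mul_zero] at h
      exact h.mono_left nhdsWithin_le_nhds
    · filter_upwards [self_mem_nhdsWithin] with α hα
      have : α * L < 2 := (lt_div_iff₀ hL).mp hα
      have : 0 < 2 - α * L := by linarith
      simp only [Set.mem_Ioi]
      positivity
  have hnum : Tendsto (fun α : ℝ => α * √L) (𝓝[<] (2 / L)) (𝓝 (2 / L * √L)) :=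
    ((continuous_mul_const _).tendsto _).mono_left nhdsWithin_le_nhds
  simpa only [div_eq_mul_inv, Function.comp_def] using
    hnum.pos_mul_atTop (by positivity) (tendsto_inv_nhdsGT_zero.comp hden)

/-! ### Both norms equal the closed form -/

section Main

variable {d : ℕ} {Q : Matrix (Fin d) (Fin d) ℝ} {p : EuclideanSpace ℝ (Fin d)} {r : ℝ}
  {xs : EuclideanSpace ℝ (Fin d)} {U : Matrix (Fin d) (Fin d) ℝ} {lam : Fin d → ℝ} {α : ℝ}

theorem spectrum_eq_range_of_decomp (hU : Uᵀ * U = 1)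
    (hdec : Q = U * Matrix.diagonal lam * Uᵀ) : spectrum ℝ Q = Set.range lam := by
  let u : (Matrix (Fin d) (Fin d) ℝ)ˣ := ⟨U, Uᵀ, mul_eq_one_comm.mp hU, hU⟩
  have h := spectrum.units_conjugate (R := ℝ) (a := Matrix.diagonal lam) (u := u)
  rw [spectrum_diagonal] at h
  rw [hdec]
  exact h

theorem abs_one_sub_mul_lt_one {l L : ℝ} (hα : 0 < α) (hl : 0 < l) (hlL : l ≤ L)
    (hαL : α * L < 2) : |1 - α * l| < 1 := by
  have := mul_pos hα hl
  have := mul_le_mul_of_nonneg_left hlL hα.le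
  rw [abs_lt]
  constructor <;> linarith

theorem gdGain_le_of_mode_le (hpos : ∀ i, 0 < lam i) (hα : 0 < α) {i j : Fin d} {c : ℝ}
    (hc : 0 ≤ c) (hi : lam i / 2 * (α / (1 - 1 * (1 - α * lam i))) ^ 2 ≤ c ^ 2)
    (hj : lam j / 2 * (α / (1 - -1 * (1 - α * lam j))) ^ 2 ≤ c ^ 2) :
    gdGain (lam i) (lam j) α ≤ c := by
  rw [← one_div_sqrt_sq (hpos i) hα] at hi
  rw [← sqrt_div_sq (hpos j).le] at hj
  exact max_le ((le_abs_self _).trans (abs_le_of_sq_le_sq hi hc)) ((le_abs_self _).trans (abs_le_of_sq_le_sq hj hc))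

theorem l2Gain_eq_gdGain (hU : Uᵀ * U = 1) (hdec : Q = U * Matrix.diagonal lam * Uᵀ)
    (hxs : ∀ x, quadObjective Q p r xs ≤ quadObjective Q p r x) (hpos : ∀ i, 0 < lam i)
    {i j : Fin d} (hi : ∀ k, lam i ≤ lam k) (hj : ∀ k, lam k ≤ lam j)
    (hα : 0 < α) (hαL : α * lam j < 2) :
    l2Gain (quadObjective Q p r) xs α 0 0 = ENNReal.ofReal (gdGain (lam i) (lam j) α) := by
  have habs : ∀ k, |1 - α * lam k| < 1 := fun k =>
    abs_one_sub_mul_lt_one hα (hpos k) (hj k) hαL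
  refine le_antisymm ?_ (le_iInf₂ fun γ hγ => ?_)
  · refine iInf₂_le (gdGain (lam i) (lam j) α).toNNReal
      (hasL2GainLE_of_modes hU hdec hxs (fun k => (hpos k).le) habs fun k => ?_)
    rw [Real.coe_toNNReal _ (gdGain_nonneg _ _ _)]
    exact mode_gain_le_gdGain_sq (hpos i) hα hαL (hi k) (hj k)
  · rw [← ENNReal.ofReal_coe_nnreal]
    exact ENNReal.ofReal_le_ofReal (gdGain_le_of_mode_le hpos hα γ.coe_nonneg
      (hγ.mode_le hU hdec hxs (fun k => (hpos k).le) i (habs i) (one_pow 2))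
      (hγ.mode_le hU hdec hxs (fun k => (hpos k).le) j (habs j) (by norm_num)))

theorem norm_modalTransfer_apply_sq {i : Fin d} (hi : 0 ≤ lam i) (z : ℂ) :
    ‖modalTransfer lam α z i‖ ^ 2 =
      lam i * α ^ 2 / (2 * ‖z - ((1 - α * lam i : ℝ) : ℂ)‖ ^ 2) := by
  rw [modalTransfer, norm_div, Complex.norm_real, Real.norm_eq_abs, div_pow, sq_abs, neg_sq,
    mul_pow, div_pow, Real.sq_sqrt hi, Real.sq_sqrt zero_le_two]
  ring

/-- A point of the unit circle lies at distance at least `1 - |a|` from the real pole `a`. -/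
theorem norm_modalTransfer_le (hpos : ∀ i, 0 < lam i)
    {i j : Fin d} (hi : ∀ k, lam i ≤ lam k) (hj : ∀ k, lam k ≤ lam j)
    (hα : 0 < α) (hαL : α * lam j < 2) {z : ℂ} (hz : ‖z‖ = 1) :
    ‖modalTransfer lam α z‖ ≤ gdGain (lam i) (lam j) α := by
  refine (pi_norm_le_iff_of_nonneg (gdGain_nonneg _ _ _)).mpr fun k =>
    (le_abs_self _).trans (abs_le_of_sq_le_sq ?_ (gdGain_nonneg _ _ _))
  refine le_trans ?_ (mode_gain_le_gdGain_sq (hpos i) hα hαL (hi k) (hj k))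
  have h1 : 0 < 1 - |1 - α * lam k| := by
    linarith [abs_one_sub_mul_lt_one hα (hpos k) (hj k) hαL]
  have h2 : 1 - |1 - α * lam k| ≤ ‖z - ((1 - α * lam k : ℝ) : ℂ)‖ := by
    have := norm_sub_norm_le z ((1 - α * lam k : ℝ) : ℂ)
    rwa [hz, Complex.norm_real, Real.norm_eq_abs] at this
  have h3 := (hpos k).le
  rw [norm_modalTransfer_apply_sq h3]
  gcongr

/-- At `z = s = ±1` one has `|s - a| = |1 - s a|`, so the frequency response there equals the
steady-state value from the time-domain lower bound. -/
theorem mode_le_norm_modalTransfer_sq {i : Fin d} (hi : 0 ≤ lam i) {s : ℝ} (hs : s ^ 2 = 1) :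
    lam i / 2 * (α / (1 - s * (1 - α * lam i))) ^ 2 ≤ ‖modalTransfer lam α s‖ ^ 2 := by
  have h : lam i / 2 * (α / (1 - s * (1 - α * lam i))) ^ 2 = ‖modalTransfer lam α s i‖ ^ 2 := by
    rw [norm_modalTransfer_apply_sq hi, ← Complex.ofReal_sub, Complex.norm_real,
      Real.norm_eq_abs, sq_abs]
    have : (s - (1 - α * lam i)) ^ 2 = (1 - s * (1 - α * lam i)) ^ 2 := by
      linear_combination (1 - (1 - α * lam i) ^ 2) * hs
    rw [this, div_pow, div_mul_div_comm]
  rw [h]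
  exact pow_le_pow_left₀ (norm_nonneg _) (norm_le_pi_norm _ i) 2

theorem hInfNorm_eq_gdGain (hU : Uᵀ * U = 1) (hdec : Q = U * Matrix.diagonal lam * Uᵀ)
    (hpos : ∀ i, 0 < lam i)
    {i j : Fin d} (hi : ∀ k, lam i ≤ lam k) (hj : ∀ k, lam k ≤ lam j)
    (hα : 0 < α) (hαL : α * lam j < 2) :
    hInfNorm Q U lam α 0 0 = ENNReal.ofReal (gdGain (lam i) (lam j) α) ∧
      ∃ z : Circle, ENNReal.ofReal (transferNorm Q U lam α 0 0 z) = hInfNorm Q U lam α 0 0 := by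
  have hT : ∀ z : Circle, transferNorm Q U lam α 0 0 z = ‖modalTransfer lam α z‖ := by
    intro z
    refine transferNorm_eq hU hdec z.coe_ne_zero fun k hk => ?_
    have h := congrArg norm hk
    rw [Circle.norm_coe, Complex.norm_real, Real.norm_eq_abs] at h
    exact (abs_one_sub_mul_lt_one hα (hpos k) (hj k) hαL).ne' h
  have hle : ∀ z : Circle, transferNorm Q U lam α 0 0 z ≤ gdGain (lam i) (lam j) α := fun z => by
    rw [hT]
    exact norm_modalTransfer_le hpos hi hj hα hαL z.norm_coe
  have hmem : (-1 : ℂ) ∈ Submonoid.unitSphere ℂ := by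
    simp [Submonoid.unitSphere]
  set zm : Circle := ⟨-1, hmem⟩ with hzm
  have h1 := mode_le_norm_modalTransfer_sq (α := α) (hpos i).le (one_pow 2)
  have h2 := mode_le_norm_modalTransfer_sq (α := α) (s := -1) (hpos j).le (by norm_num)
  have hT1 : transferNorm Q U lam α 0 0 (1 : Circle) = ‖modalTransfer lam α (1 : ℝ)‖ := by
    rw [hT]; simp
  have hT2 : transferNorm Q U lam α 0 0 zm = ‖modalTransfer lam α (-1 : ℝ)‖ := by
    rw [hT]; simp [hzm]
  rw [← hT1] at h1
  rw [← hT2] at h2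
  obtain ⟨z, hz⟩ : ∃ z : Circle, transferNorm Q U lam α 0 0 z = gdGain (lam i) (lam j) α := by
    -- The point `1` handles the smallest eigenvalue and `-1` the largest, so one of them attains
    -- the maximum.
    have hmax : gdGain (lam i) (lam j) α ≤
        max (transferNorm Q U lam α 0 0 (1 : Circle)) (transferNorm Q U lam α 0 0 zm) :=
      have hn : ∀ z : ℂ, 0 ≤ transferNorm Q U lam α 0 0 z := fun z => norm_nonneg _
      gdGain_le_of_mode_le hpos hα (le_max_of_le_left (hn _))
        (h1.trans (pow_le_pow_left₀ (hn _) (le_max_left _ _) 2))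
        (h2.trans (pow_le_pow_left₀ (hn _) (le_max_right _ _) 2))
    rcases le_max_iff.mp hmax with h | h
    · exact ⟨_, le_antisymm (hle _) h⟩
    · exact ⟨_, le_antisymm (hle _) h⟩
  have heq : hInfNorm Q U lam α 0 0 = ENNReal.ofReal (gdGain (lam i) (lam j) α) :=
    le_antisymm (iSup_le fun z => ENNReal.ofReal_le_ofReal (hle z))
      (hz ▸ le_iSup (fun z : Circle => ENNReal.ofReal (transferNorm Q U lam α 0 0 z)) z)
  exact ⟨heq, z, by rw [hz, heq]⟩

end Main

theorem mainTheorem4 (d : ℕ) (Q : Matrix (Fin d) (Fin d) ℝ) (hQ : Q.PosDef)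
    (p : EuclideanSpace ℝ (Fin d)) (r : ℝ)
    -- `xs` is the minimizer of `f`
    (xs : EuclideanSpace ℝ (Fin d)) (hxs : ∀ x, quadObjective Q p r xs ≤ quadObjective Q p r x)
    -- `μ` and `L` are the smallest and the largest eigenvalue of `Q`
    (μ L : ℝ) (hμ : IsLeast (spectrum ℝ Q) μ) (hL : IsGreatest (spectrum ℝ Q) L)
    -- any eigenvalue decomposition `Q = U Λ Uᵀ`, used in the output matrix `T`
    (U : Matrix (Fin d) (Fin d) ℝ) (hU : U ∈ Matrix.orthogonalGroup (Fin d) ℝ)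
    (lam : Fin d → ℝ) (hdec : Q = U * Matrix.diagonal lam * Uᵀ) :
    -- coefficients for GD
    (∀ α l : ℝ, gmmc α 0 0 l = 0 ∧ gmmb α 0 0 l = α * l - 1) ∧
    -- GD is globally convergent exactly for stepsizes below `2 / L`
    (∀ α : ℝ, 0 < α → (spectralRadius ℂ (gmmA Q α 0 0) < 1 ↔ α < 2 / L)) ∧
    -- the `ℓ₂` gain is the `H_∞` norm, the maximum of `‖G(z)‖` over the unit circle
    (∀ α : ℝ, 0 < α → α < 2 / L →
      l2Gain (quadObjective Q p r) xs α 0 0 = hInfNorm Q U lam α 0 0 ∧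
      ∃ z : Circle, ENNReal.ofReal (transferNorm Q U lam α 0 0 z) = hInfNorm Q U lam α 0 0) ∧
    -- its value
    (∀ α : ℝ, 0 < α → α ≤ 2 / (L + √(L * μ)) →
      hInfNorm Q U lam α 0 0 = ENNReal.ofReal (1 / √(2 * μ))) ∧
    (∀ α : ℝ, 2 / (L + √(L * μ)) < α → α < 2 / L →
      hInfNorm Q U lam α 0 0 = ENNReal.ofReal (α * √L / (√2 * (2 - α * L)))) ∧
    -- blow-up
    Tendsto (fun α : ℝ => l2Gain (quadObjective Q p r) xs α 0 0) (𝓝[<] (2 / L)) (𝓝 ⊤) ∧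
    Tendsto (fun α : ℝ => hInfNorm Q U lam α 0 0) (𝓝[<] (2 / L)) (𝓝 ⊤) := by
  have hU1 : Uᵀ * U = 1 := (Matrix.mem_orthogonalGroup_iff' (Fin d) ℝ).mp hU
  have hspec := spectrum_eq_range_of_decomp hU1 hdec
  rw [hspec] at hμ hL
  obtain ⟨⟨i, rfl⟩, hi⟩ := hμ
  obtain ⟨⟨j, rfl⟩, hj⟩ := hL
  replace hi : ∀ k, lam i ≤ lam k := fun k => hi ⟨k, rfl⟩
  replace hj : ∀ k, lam k ≤ lam j := fun k => hj ⟨k, rfl⟩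
  have hpos : ∀ k, 0 < lam k := fun k => by
    have hk : lam k ∈ spectrum ℝ Q := hspec ▸ ⟨k, rfl⟩
    rw [hQ.isHermitian.spectrum_real_eq_range_eigenvalues] at hk
    obtain ⟨m, hm⟩ := hk
    exact hm ▸ hQ.eigenvalues_pos m
  have hd : d ≠ 0 := fun h => (h ▸ i).elim0
  have hgain : ∀ α : ℝ, 0 < α → α < 2 / lam j →
      l2Gain (quadObjective Q p r) xs α 0 0 = ENNReal.ofReal (gdGain (lam i) (lam j) α) :=
    fun α h0 h => l2Gain_eq_gdGain hU1 hdec hxs hpos hi hj h0 ((lt_div_iff₀ (hpos j)).mp h)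
  have hinf := fun (α : ℝ) (h0 : 0 < α) (h : α < 2 / lam j) =>
    hInfNorm_eq_gdGain hU1 hdec hpos hi hj h0 ((lt_div_iff₀ (hpos j)).mp h)
  have htop : Tendsto (fun α => ENNReal.ofReal (gdGain (lam i) (lam j) α))
      (𝓝[<] (2 / lam j)) (𝓝 ⊤) :=
    ENNReal.tendsto_ofReal_atTop.comp (tendsto_gdGain (hpos j))
  have hev : ∀ᶠ α : ℝ in 𝓝[<] (2 / lam j), 0 < α ∧ α < 2 / lam j :=
    Ioo_mem_nhdsLT (div_pos two_pos (hpos j))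
  have hrt : 0 < √(lam j * lam i) := Real.sqrt_pos.mpr (mul_pos (hpos j) (hpos i))
  refine ⟨fun α l => ⟨by simp [gmmc], by simp [gmmb]⟩, fun α h0 => ?_, fun α h0 h => ?_,
    fun α h0 h => ?_, fun α h0 h => ?_, ?_, ?_⟩
  · rw [spectralRadius_gmmA_lt_one_iff hU1 hdec hd, lt_div_iff₀ (hpos j)]
    refine ⟨fun h => ?_, fun h k => abs_one_sub_mul_lt_one h0 (hpos k) (hj k) h⟩
    linarith [(abs_lt.mp (h j)).1]
  · exact ⟨(hgain α h0 h).trans (hinf α h0 h).1.symm, (hinf α h0 h).2⟩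
  -- The first threshold lies strictly below `2 / L` because `√(L μ) > 0`.
  · have h' : α < 2 / lam j := h.trans_lt
      (div_lt_div_of_pos_left two_pos (hpos j) (lt_add_of_pos_right _ hrt))
    rw [(hinf α h0 h').1, gdGain_of_le (hpos i) (hpos j) h h']
  · have h0' : 0 < α := (div_pos two_pos (add_pos (hpos j) hrt)).trans h0
    rw [(hinf α h0' h).1, gdGain_of_lt (hpos i) (hpos j) h0 h]
  · exact htop.congr' (hev.mono fun α h => (hgain α h.1 h.2).symm)
  · exact htop.congr' (hev.mono fun α h => (hinf α h.1 h.2).1.symm)
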